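/- Let $d\ge 1$ and let $\mathcal X\subset\mathbb R^d$ be an action set with $\|x\|_2^2\le d$ for all $x\in\mathcal X$ that contains the standard basis vectors $e_1,\dots,e_d$ (for example $\mathcal X=[0,1]^d$). Consider the misspecified linear bandit model in which playing $x_t\in\mathcal X$ in round $t=1,2,\dots$ yields the reward $y_t=\langle x_t,\theta^*\rangle+b(x_t)+\eta_t$, where $\theta^*\in\mathbb R^d$ is fixed and unknown, $|b(x)|\le\epsilon$ and $\langle x,\theta^*\rangle+b(x)\in[-1,1]$ for all $x\in\mathcal X$, and the noise $\eta_t$ is, conditionally on $x_1,\eta_1,\dots,x_{t-1},\eta_{t-1},x_t$ (and any internal randomization up to the choice of $x_t$), zero-mean and sub-Gaussian with parameter $\sigma$, i.e. $\mathbb E[e^{\lambda\eta_t}\mid\text{past}]\le e^{\lambda^2\sigma^2/2}$ for all $\lambda\in\mathbb R$ (for example i.i.d. noise). Assume $(1+\epsilon)/\sigma\le 7$ and let $0<\delta<1$. The modified ConfidenceBall$_2$ algorithm (misspecified linear UCB) knows $\mathcal X,d,\epsilon,\sigma,\delta$ and starts with an arbitrary, possibly random, $x_1\in\mathcal X$.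 With, for $t\ge 1$, $$A_t=I_d+\sum_{s=1}^{t-1}x_sx_s^T,\qquad \hat\theta_t=A_t^{-1}\sum_{s=1}^{t-1}y_sx_s,\qquad \beta_t=128\,\sigma^2d\,\ln(1+(t-1))\,\ln\!\Big(\frac{4t^2}{\delta}\Big),$$ $$UCB_t(x)=\langle x,\hat\theta_t\rangle+\sqrt{\beta_t}\,\|A_t^{-1/2}x\|_2+\epsilon\sum_{s=1}^{t-1}|x^TA_t^{-1}x_s|,$$ it plays $x_{t}\in\arg\max_{x\in\mathcal X}UCB_{t}(x)$ in every round $t\ge 2$ (ties broken arbitrarily). Let $R(T)=\sum_{t=1}^T\big(\sup_{x\in\mathcal X}\langle x,\theta^*\rangle-\langle x_t,\theta^*\rangle\big)$ be the pseudo-regret of the linear model. Then, with probability at least $1-\delta$, simultaneously for all $T\ge 2$, $$R(T)\le\sqrt{8d\beta_T\,T\ln(1+T)}+2\epsilon Td\sqrt{2\ln(1+T)}+2\epsilon T.$$ -/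

import Mathlib

open MeasureTheory

noncomputable section

namespace MisLinUCB

/-! Rounds are numbered `1, 2, 3, …`; the entries of the sequences at index `0` play no role.
Vectors of `ℝᵈ` are functions `Fin d → ℝ`, with inner product `x ⬝ᵥ z`. -/

variable {d : ℕ}

/-- `A_t = I_d + ∑_{s=1}^{t-1} x_s x_sᵀ`; in particular `A_1 = I_d` and
`A_{t+1} = A_t + x_t x_tᵀ` for `t ≥ 1`. -/
def gram (x : ℕ → Fin d → ℝ) (t : ℕ) : Matrix (Fin d) (Fin d) ℝ :=
  1 + ∑ s ∈ Finset.Ico 1 t, Matrix.vecMulVec (x s) (x s)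

/-- `θ̂_t = A_t⁻¹ ∑_{s=1}^{t-1} y_s x_s`. -/
def thetaHat (x : ℕ → Fin d → ℝ) (y : ℕ → ℝ) (t : ℕ) : Fin d → ℝ :=
  Matrix.mulVec (gram x t)⁻¹ (∑ s ∈ Finset.Ico 1 t, y s • x s)

/-- `β_t = 128 σ² d ln(1 + (t - 1)) ln(4 t² / δ)`. -/
def beta (d : ℕ) (σ δ : ℝ) (t : ℕ) : ℝ :=
  128 * σ ^ 2 * d * Real.log (1 + ((t : ℝ) - 1)) * Real.log (4 * (t : ℝ) ^ 2 / δ)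

/-- `UCB_t(z) = ⟨z, θ̂_t⟩ + √β_t ‖A_t^{-1/2} z‖ + ε ∑_{s=1}^{t-1} |zᵀ A_t⁻¹ x_s|`, where
`‖A_t^{-1/2} z‖` is written as `√(zᵀ A_t⁻¹ z)`. -/
def ucb (ε σ δ : ℝ) (x : ℕ → Fin d → ℝ) (y : ℕ → ℝ) (t : ℕ) (z : Fin d → ℝ) : ℝ :=
  z ⬝ᵥ thetaHat x y t
    + Real.sqrt (beta d σ δ t) * Real.sqrt (z ⬝ᵥ Matrix.mulVec (gram x t)⁻¹ z)
    + ε * ∑ s ∈ Finset.Ico 1 t, |z ⬝ᵥ Matrix.mulVec (gram x t)⁻¹ (x s)|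

/-- The actions `x_1, x_2, …` and rewards `y_1, y_2, …` form a run of the misspecified linear UCB
algorithm on the action set `X`: the first action is any element of `X`, and each later action
maximizes the current index over `X` (ties are broken arbitrarily). -/
structure IsRun (X : Set (Fin d → ℝ)) (ε σ δ : ℝ) (x : ℕ → Fin d → ℝ) (y : ℕ → ℝ) : Prop where
  first_mem : x 1 ∈ X
  next_mem : ∀ t, 1 ≤ t → x (t + 1) ∈ X
  next_max : ∀ t, 1 ≤ t → IsMaxOn (ucb ε σ δ x y (t + 1)) X (x (t + 1))

/-- The pseudo-regret `R(T) = ∑_{t=1}^T (max_{z ∈ X} ⟨z, θ⟩ - ⟨x_t, θ⟩)` of the linear model. -/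
def regret (X : Set (Fin d → ℝ)) (θ : Fin d → ℝ) (x : ℕ → Fin d → ℝ) (T : ℕ) : ℝ :=
  ∑ t ∈ Finset.Icc 1 T, ((⨆ z : X, (z : Fin d → ℝ) ⬝ᵥ θ) - x t ⬝ᵥ θ)

/-- Conditionally on the sub-σ-algebra `m`, the real random variable `η` is centred and sub-Gaussian
with parameter `σ`: `E[exp(l η) | m] ≤ exp(l² σ² / 2)` almost surely for every real `l`, the
expectation being finite. (Centring is implied by the bound near `l = 0`.) -/
def IsCondSubgaussian {Ω : Type*} {mΩ : MeasurableSpace Ω} (μ : Measure Ω)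
    (m : MeasurableSpace Ω) (σ : ℝ) (η : Ω → ℝ) : Prop :=
  ∀ l : ℝ, Integrable (fun ω => Real.exp (l * η ω)) μ ∧
    μ[fun ω => Real.exp (l * η ω) | m] ≤ᵐ[μ] fun _ => Real.exp (l ^ 2 * σ ^ 2 / 2)

end MisLinUCB

end

noncomputable section

namespace MisLinUCB

open Matrix Filter Topology ProbabilityTheory
open scoped ENNReal

/-! ### Quadratic forms, rank-one updates and determinants. -/

section LinearAlgebra

variable {n : Type*} [Fintype n]

/-! The argument is optimism plus a self-normalized tail bound. Write `S_t` for the sum of `η_s x_s`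
over `s < t`, and `‖·‖` for the norm of `A_t⁻¹`. By `dotProduct_thetaHat`, the error of `θ̂_t` in
direction `z` splits into a ridge term, a noise term and a bias term. The first two are at most `‖z‖
‖θ‖` and `‖z‖ ‖S_t‖`; the bias is at most the `ε`-sum in the index.

`‖S_t‖` is controlled for all times at once because `exp(‖S_t‖² / (2σ²)) / √(det A_t)` is a
nonnegative supermartingale started at 1. It is the average of `exp(⟨λ, S_t⟩ - σ² ∑ ⟨λ, x_s⟩² / 2)`
over a Gaussian `λ`, but only a scalar Gaussian is integrated per round: given the past, the tilted
law of `λ` is Gaussian with mean `A_t⁻¹ S_t / σ²` and covariance `A_t⁻¹ / σ²`, so only the law of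
`⟨λ, x_t⟩` matters (`lintegral_exp_gaussianReal`, `mixture_succ`). Ville's inequality then gives one
good event of probability at least `1 - δ`.

On that event everything is deterministic. For `t ≥ 2`, `√β_t` dominates both norms
(`sqrt_add_le_sqrt_beta`), so regret per round is at most twice the bonus (`iSup_sub_le`). Summation
uses the telescoping of `log det A_t` (`sum_log_one_add_le`) and, for the bias, Cauchy–Schwarz
(`sum_bias_le`). -/

lemma dotProduct_mulVec_comm_of_posSemidef {A : Matrix n n ℝ} (hA : A.PosSemidef) (u v : n → ℝ) :
    u ⬝ᵥ A *ᵥ v = v ⬝ᵥ A *ᵥ u := by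
  have h : Aᵀ = A := by simpa using hA.1.eq
  rw [dotProduct_mulVec, ← mulVec_transpose, h, dotProduct_comm]

lemma quadForm_nonneg {A : Matrix n n ℝ} (hA : A.PosSemidef) (u : n → ℝ) :
    0 ≤ u ⬝ᵥ A *ᵥ u := by
  simpa using hA.dotProduct_mulVec_nonneg u

lemma sq_dotProduct_mulVec_le {A : Matrix n n ℝ} (hA : A.PosSemidef) (u v : n → ℝ) :
    (u ⬝ᵥ A *ᵥ v) ^ 2 ≤ (u ⬝ᵥ A *ᵥ u) * (v ⬝ᵥ A *ᵥ v) := by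
  have h := discrim_le_zero (a := v ⬝ᵥ A *ᵥ v) (b := 2 * (u ⬝ᵥ A *ᵥ v)) (c := u ⬝ᵥ A *ᵥ u)
    fun r => by
      have h := quadForm_nonneg hA (u + r • v)
      rw [mulVec_add, mulVec_smul, dotProduct_add, add_dotProduct, add_dotProduct,
        dotProduct_smul, dotProduct_smul, smul_dotProduct, smul_dotProduct,
        dotProduct_mulVec_comm_of_posSemidef hA v u] at h
      simp only [smul_eq_mul] at h
      linarith
  rw [discrim] at h
  nlinarith

lemma abs_dotProduct_mulVec_le {A : Matrix n n ℝ} (hA : A.PosSemidef) (u v : n → ℝ) :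
    |u ⬝ᵥ A *ᵥ v| ≤ √(u ⬝ᵥ A *ᵥ u) * √(v ⬝ᵥ A *ᵥ v) := by
  rw [← Real.sqrt_mul (quadForm_nonneg hA u)]
  exact Real.abs_le_sqrt (sq_dotProduct_mulVec_le hA u v)

lemma posSemidef_vecMulVec (x : n → ℝ) : (vecMulVec x x).PosSemidef := by
  simpa using posSemidef_vecMulVec_self_star x

variable [DecidableEq n]

lemma mulVec_inv_mulVec {A : Matrix n n ℝ} (hA : A.PosDef) (z : n → ℝ) :
    A *ᵥ (A⁻¹ *ᵥ z) = z := by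
  rw [mulVec_mulVec, mul_nonsing_inv _ ((isUnit_iff_isUnit_det A).1 hA.isUnit), one_mulVec]

lemma inv_mulVec_mulVec {A : Matrix n n ℝ} (hA : A.PosDef) (z : n → ℝ) :
    A⁻¹ *ᵥ (A *ᵥ z) = z := by
  rw [mulVec_mulVec, nonsing_inv_mul _ ((isUnit_iff_isUnit_det A).1 hA.isUnit), one_mulVec]

lemma det_add_vecMulVec {A : Matrix n n ℝ} (hA : A.PosDef) (x : n → ℝ) :
    (A + vecMulVec x x).det = A.det * (1 + x ⬝ᵥ A⁻¹ *ᵥ x) := by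
  rw [vecMulVec_eq Unit, det_add_replicateCol_mul_replicateRow
    ((isUnit_iff_isUnit_det A).1 hA.isUnit), ← replicateRow_vecMul]
  congr 2
  simp [dotProduct_mulVec]

/-- The Sherman–Morrison formula, applied to a vector. -/
lemma inv_add_vecMulVec_mulVec {A : Matrix n n ℝ} (hA : A.PosDef) (x v : n → ℝ) :
    (A + vecMulVec x x)⁻¹ *ᵥ v =
      A⁻¹ *ᵥ v - ((x ⬝ᵥ A⁻¹ *ᵥ v) / (1 + x ⬝ᵥ A⁻¹ *ᵥ x)) • (A⁻¹ *ᵥ x) := by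
  have hw : 0 ≤ x ⬝ᵥ A⁻¹ *ᵥ x := quadForm_nonneg hA.inv.posSemidef x
  have hB : (A + vecMulVec x x).PosDef := hA.add_posSemidef (posSemidef_vecMulVec x)
  rw [← inv_mulVec_mulVec hB (A⁻¹ *ᵥ v - _)]
  congr 1
  rw [mulVec_sub, mulVec_smul, add_mulVec, add_mulVec, mulVec_inv_mulVec hA, mulVec_inv_mulVec hA,
    vecMulVec_mulVec, vecMulVec_mulVec]
  ext i
  simp
  field_simp
  ring

lemma quadForm_inv_add_vecMulVec {A : Matrix n n ℝ} (hA : A.PosDef) (x v : n → ℝ) (c : ℝ) :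
    (v + c • x) ⬝ᵥ (A + vecMulVec x x)⁻¹ *ᵥ (v + c • x) =
      v ⬝ᵥ A⁻¹ *ᵥ v + (2 * c * (x ⬝ᵥ A⁻¹ *ᵥ v) + c ^ 2 * (x ⬝ᵥ A⁻¹ *ᵥ x) -
        (x ⬝ᵥ A⁻¹ *ᵥ v) ^ 2) / (1 + x ⬝ᵥ A⁻¹ *ᵥ x) := by
  have hw : 0 ≤ x ⬝ᵥ A⁻¹ *ᵥ x := quadForm_nonneg hA.inv.posSemidef x
  rw [inv_add_vecMulVec_mulVec hA]
  simp only [mulVec_add, mulVec_smul, dotProduct_add, add_dotProduct, dotProduct_sub,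
    dotProduct_smul, smul_dotProduct, smul_eq_mul,
    dotProduct_mulVec_comm_of_posSemidef hA.inv.posSemidef v x]
  field_simp
  ring

/-- AM–GM for the eigenvalues, in logarithmic form: sum the tangent-line bound of `log` at `r` over
the spectrum. -/
lemma det_le_pow_of_trace_le {A : Matrix n n ℝ} (hA : A.PosDef) {r : ℝ} (hr : 0 < r)
    (htr : A.trace ≤ Fintype.card n * r) : Real.log A.det ≤ Fintype.card n * Real.log r := by
  have hev := hA.eigenvalues_pos
  rw [hA.1.trace_eq_sum_eigenvalues] at htr
  rw [hA.1.det_eq_prod_eigenvalues]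
  simp only [RCLike.ofReal_real_eq_id, id] at htr ⊢
  rw [Real.log_prod fun i _ => (hev i).ne']
  have h : ∀ i, Real.log (hA.1.eigenvalues i) ≤ Real.log r + (hA.1.eigenvalues i / r - 1) := by
    intro i
    have := Real.log_le_sub_one_of_pos (div_pos (hev i) hr)
    rw [Real.log_div (hev i).ne' hr.ne'] at this
    linarith
  calc _ ≤ ∑ i, (Real.log r + (hA.1.eigenvalues i / r - 1)) := Finset.sum_le_sum fun i _ => h i
    _ = Fintype.card n * Real.log r + ((∑ i, hA.1.eigenvalues i) / r - Fintype.card n) := by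
      simp [Finset.sum_add_distrib, Finset.sum_sub_distrib, Finset.sum_div]
    _ ≤ _ := by
      have : (∑ i, hA.1.eigenvalues i) / r ≤ Fintype.card n := (div_le_iff₀ hr).2 htr
      linarith

end LinearAlgebra

/-! ### The regularized Gram matrix of the actions. -/

section Gram

variable {d : ℕ} (x : ℕ → Fin d → ℝ)

lemma gram_one : gram x 1 = 1 := by simp [gram]

lemma gram_succ {t : ℕ} (ht : 1 ≤ t) :
    gram x (t + 1) = gram x t + vecMulVec (x t) (x t) := by
  simp [gram, Finset.sum_Ico_succ_top ht, add_assoc]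

lemma gram_posDef (t : ℕ) : (gram x t).PosDef :=
  Matrix.PosDef.one.add_posSemidef (posSemidef_sum _ fun s _ => posSemidef_vecMulVec (x s))

lemma quadForm_gram (t : ℕ) (v : Fin d → ℝ) :
    v ⬝ᵥ gram x t *ᵥ v = v ⬝ᵥ v + ∑ s ∈ Finset.Ico 1 t, (x s ⬝ᵥ v) ^ 2 := by
  rw [gram, add_mulVec, one_mulVec, dotProduct_add, sum_mulVec, dotProduct_sum]
  congr 1
  refine Finset.sum_congr rfl fun s _ => ?_
  rw [vecMulVec_mulVec]
  simp [dotProduct_comm v, sq]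

/-- Evaluate the quadratic form of `A_t` at `A_t⁻¹ z`. Both summands are nonnegative; dropping
either one gives a bound used below. -/
lemma quadForm_gram_inv_eq (t : ℕ) (z : Fin d → ℝ) :
    z ⬝ᵥ (gram x t)⁻¹ *ᵥ z = ((gram x t)⁻¹ *ᵥ z) ⬝ᵥ ((gram x t)⁻¹ *ᵥ z) +
      ∑ s ∈ Finset.Ico 1 t, (z ⬝ᵥ (gram x t)⁻¹ *ᵥ x s) ^ 2 := by
  have h := quadForm_gram x t ((gram x t)⁻¹ *ᵥ z)
  rw [mulVec_inv_mulVec (gram_posDef x t), dotProduct_comm] at h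
  simpa only [dotProduct_mulVec_comm_of_posSemidef (gram_posDef x t).inv.posSemidef z] using h

lemma quadForm_gram_inv_nonneg (t : ℕ) (z : Fin d → ℝ) : 0 ≤ z ⬝ᵥ (gram x t)⁻¹ *ᵥ z :=
  quadForm_nonneg (gram_posDef x t).inv.posSemidef z

lemma sum_sq_le_quadForm_gram_inv (t : ℕ) (z : Fin d → ℝ) :
    ∑ s ∈ Finset.Ico 1 t, (z ⬝ᵥ (gram x t)⁻¹ *ᵥ x s) ^ 2 ≤ z ⬝ᵥ (gram x t)⁻¹ *ᵥ z := by
  rw [quadForm_gram_inv_eq x t z]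
  have : 0 ≤ ((gram x t)⁻¹ *ᵥ z) ⬝ᵥ ((gram x t)⁻¹ *ᵥ z) := by
    simpa using dotProduct_self_star_nonneg ((gram x t)⁻¹ *ᵥ z)
  linarith

/-- This is `A_t ≥ I` inverted: with `q = zᵀ A_t⁻¹ z`, Cauchy–Schwarz and `|A_t⁻¹ z|² ≤ q` give `q²
≤ |z|² q`. -/
lemma quadForm_gram_inv_le (t : ℕ) (z : Fin d → ℝ) : z ⬝ᵥ (gram x t)⁻¹ *ᵥ z ≤ z ⬝ᵥ z := by
  have h1 : ((gram x t)⁻¹ *ᵥ z) ⬝ᵥ ((gram x t)⁻¹ *ᵥ z) ≤ z ⬝ᵥ (gram x t)⁻¹ *ᵥ z := by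
    rw [quadForm_gram_inv_eq x t z]
    exact le_add_of_nonneg_right (Finset.sum_nonneg fun _ _ => sq_nonneg _)
  have h2 := sq_dotProduct_mulVec_le (Matrix.PosSemidef.one (n := Fin d) (R := ℝ)) z
    ((gram x t)⁻¹ *ᵥ z)
  simp only [one_mulVec] at h2
  have h0 := quadForm_gram_inv_nonneg x t z
  have hz : 0 ≤ z ⬝ᵥ z := by simpa using dotProduct_self_star_nonneg z
  rcases h0.eq_or_lt with h | h
  · rwa [← h]
  · nlinarith

/-- The trace is at most `d + (t - 1) d = d t`, so the mean eigenvalue is at most `t`. -/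
lemma log_det_gram_le {X : Set (Fin d → ℝ)} (hX : ∀ z ∈ X, z ⬝ᵥ z ≤ (d : ℝ))
    (hx : ∀ t, 1 ≤ t → x t ∈ X) {t : ℕ} (ht : 1 ≤ t) :
    Real.log (gram x t).det ≤ d * Real.log t := by
  have h0 : (0 : ℝ) < t := by exact_mod_cast ht
  refine (det_le_pow_of_trace_le (gram_posDef x t) h0 ?_).trans_eq (by simp)
  rw [gram, trace_add, trace_sum]
  simp only [trace_one, Fintype.card_fin, trace_vecMulVec]
  have : ∑ s ∈ Finset.Ico 1 t, x s ⬝ᵥ x s ≤ ∑ s ∈ Finset.Ico 1 t, (d : ℝ) :=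
    Finset.sum_le_sum fun s hs => hX _ (hx s (Finset.mem_Ico.1 hs).1)
  simp only [Finset.sum_const, Nat.card_Ico, nsmul_eq_mul] at this
  rw [Nat.cast_sub ht] at this
  push_cast at this
  linarith

lemma log_det_gram_eq {t : ℕ} (ht : 1 ≤ t) : Real.log (gram x t).det =
    ∑ s ∈ Finset.Ico 1 t, Real.log (1 + x s ⬝ᵥ (gram x s)⁻¹ *ᵥ x s) := by
  induction t, ht using Nat.le_induction with
  | base => simp [gram_one]
  | succ t ht ih =>
    rw [Finset.sum_Ico_succ_top ht, gram_succ x ht, det_add_vecMulVec (gram_posDef x t),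
      Real.log_mul (gram_posDef x t).det_pos.ne'
        (by linarith [quadForm_gram_inv_nonneg x t (x t)]), ih]

end Gram

/-! ### Ville's inequality and conditionally sub-Gaussian noise. -/

lemma exists_finite_range_tendsto {Ω : Type*} {m : MeasurableSpace Ω} {Z : Ω → ℝ}
    (hZ : Measurable Z) : ∃ Z' : ℕ → Ω → ℝ, (∀ n, Measurable (Z' n)) ∧
      (∀ n, (Set.range (Z' n)).Finite) ∧ ∀ ω, Tendsto (fun n => Z' n ω) atTop (𝓝 (Z ω)) :=
  ⟨fun n => hZ.stronglyMeasurable.approx n, fun n => (hZ.stronglyMeasurable.approx n).measurable,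
    fun n => (hZ.stronglyMeasurable.approx n).finite_range,
    hZ.stronglyMeasurable.tendsto_approx⟩

section Probability

variable {Ω : Type*} {m mΩ : MeasurableSpace Ω} {μ : Measure Ω}

/-- Ville's maximal inequality for nonnegative supermartingales. -/
lemma mul_measure_exists_le {ℱ : Filtration ℕ mΩ} {a : ℕ → Ω → ℝ≥0∞}
    (ha : ∀ t, Measurable[ℱ t] (a t))
    (hstep : ∀ t s, MeasurableSet[ℱ t] s → ∫⁻ ω in s, a (t + 1) ω ∂μ ≤ ∫⁻ ω in s, a t ω ∂μ)
    (c : ℝ≥0∞) : c * μ {ω | ∃ t, c ≤ a t ω} ≤ ∫⁻ ω, a 0 ω ∂μ := by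
  set E : ℕ → Set Ω := fun t => {ω | c ≤ a t ω}
  have hE : ∀ t, MeasurableSet[ℱ t] (E t) := fun t => measurableSet_le measurable_const (ha t)
  have hD : ∀ t, MeasurableSet[ℱ t] (Set.accumulate E t) := fun t => by
    rw [Set.accumulate_def]
    exact MeasurableSet.biUnion (Set.to_countable _) fun s hs => ℱ.mono hs _ (hE s)
  have hle : ∀ t s, MeasurableSet[ℱ t] s → s ⊆ E t → c * μ s ≤ ∫⁻ ω in s, a t ω ∂μ :=
    fun t s hs hsE => by
      rw [← setLIntegral_const]
      exact setLIntegral_mono ((ha t).mono (ℱ.le t) le_rfl) fun ω hω => hsE hω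
  -- Stopping at the first passage above `c`: the mass of paths that have not crossed, plus `c`
  -- times the probability of having crossed, never exceeds the initial mass.
  have key : ∀ t, ∫⁻ ω in (Set.accumulate E t)ᶜ, a t ω ∂μ + c * μ (Set.accumulate E t)
      ≤ ∫⁻ ω, a 0 ω ∂μ := by
    intro t
    induction t with
    | zero =>
      refine le_trans ?_ (lintegral_add_compl (a 0) (ℱ.le 0 _ (hD 0))).le
      rw [add_comm]
      exact add_le_add_left (hle 0 _ (hD 0) (by simp [Set.accumulate_def])) _
    | succ t ih =>
      refine le_trans ?_ ih
      have hsucc : Set.accumulate E (t + 1) = Set.accumulate E t ∪ E (t + 1) := by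
        rw [Set.accumulate_succ]
      have hDt : MeasurableSet (Set.accumulate E t) := ℱ.le _ _ (hD t)
      have hDt' : MeasurableSet[ℱ (t + 1)] (Set.accumulate E t) :=
        ℱ.mono (Nat.le_succ t) _ (hD t)
      have h1 := hstep t _ (hD t).compl
      have h2 : ∫⁻ ω in (Set.accumulate E t)ᶜ, a (t + 1) ω ∂μ =
          ∫⁻ ω in (Set.accumulate E t)ᶜ ∩ E (t + 1), a (t + 1) ω ∂μ +
          ∫⁻ ω in (Set.accumulate E t)ᶜ \ E (t + 1), a (t + 1) ω ∂μ :=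
        (lintegral_inter_add_sdiff _ _ (ℱ.le _ _ (hE (t + 1)))).symm
      have h3 := hle (t + 1) _ (hDt'.compl.inter (hE (t + 1))) Set.inter_subset_right
      have h4 : μ (Set.accumulate E (t + 1)) ≤
          μ ((Set.accumulate E t)ᶜ ∩ E (t + 1)) + μ (Set.accumulate E t) := by
        refine (measure_mono ?_).trans (measure_union_le _ _)
        rw [hsucc]
        intro ω hω
        by_cases h : ω ∈ Set.accumulate E t <;> simp_all
      have h5 : (Set.accumulate E (t + 1))ᶜ = (Set.accumulate E t)ᶜ \ E (t + 1) := by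
        rw [hsucc, Set.compl_union, Set.sdiff_eq]
      calc _ ≤ ∫⁻ ω in (Set.accumulate E t)ᶜ \ E (t + 1), a (t + 1) ω ∂μ +
            c * (μ ((Set.accumulate E t)ᶜ ∩ E (t + 1)) + μ (Set.accumulate E t)) := by
              rw [h5]; gcongr
        _ ≤ ∫⁻ ω in (Set.accumulate E t)ᶜ \ E (t + 1), a (t + 1) ω ∂μ +
            (∫⁻ ω in (Set.accumulate E t)ᶜ ∩ E (t + 1), a (t + 1) ω ∂μ +
              c * μ (Set.accumulate E t)) := by
              rw [mul_add]; gcongr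
        _ = ∫⁻ ω in (Set.accumulate E t)ᶜ, a (t + 1) ω ∂μ + c * μ (Set.accumulate E t) := by
              rw [h2]; ring
        _ ≤ _ := by gcongr
  have hset : {ω | ∃ t, c ≤ a t ω} = ⋃ t, E t := by ext; simp [E]
  rw [hset, measure_iUnion_eq_iSup_accumulate, ENNReal.mul_iSup]
  exact iSup_le fun t => le_trans le_add_self (key t)

variable [IsProbabilityMeasure μ] {σ : ℝ} {η : Ω → ℝ}

/-- The weight `G` carries both the past of the supermartingale and the indicator of an event in
`m`; working with `lintegral` avoids any integrability condition on it. -/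
lemma IsCondSubgaussian.lintegral_const_le (hm : m ≤ mΩ) (hη : Measurable η)
    (h : IsCondSubgaussian μ m σ η) (l : ℝ) {G : Ω → ℝ≥0∞} (hG : Measurable[m] G) :
    ∫⁻ ω, G ω * ENNReal.ofReal (Real.exp (l * η ω - l ^ 2 * σ ^ 2 / 2)) ∂μ ≤ ∫⁻ ω, G ω ∂μ := by
  obtain ⟨hint, hle⟩ := h l
  set f : Ω → ℝ≥0∞ := fun ω => ENNReal.ofReal (Real.exp (l * η ω - l ^ 2 * σ ^ 2 / 2))
  have hf : Measurable f := by fun_prop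
  have hfe : ∀ ω, Real.exp (l * η ω - l ^ 2 * σ ^ 2 / 2)
      = Real.exp (-(l ^ 2 * σ ^ 2 / 2)) * Real.exp (l * η ω) := fun ω => by
    rw [← Real.exp_add]; congr 1; ring
  -- The conditional bound says that, restricted to `m`, the tilted measure is dominated by `μ`;
  -- this integrates against every `m`-measurable `G` at once.
  have hmeas : (μ.withDensity f).trim hm ≤ μ.trim hm := by
    refine Measure.le_iff.2 fun s hs => ?_
    rw [trim_measurableSet_eq hm hs, trim_measurableSet_eq hm hs, withDensity_apply _ (hm s hs),
      ← ofReal_integral_eq_lintegral_ofReal]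
    · refine ENNReal.ofReal_le_of_le_toReal ?_
      simp_rw [hfe]
      rw [integral_const_mul, ← setIntegral_condExp hm hint hs]
      have h1 : ∫ ω in s, (μ[fun ω => Real.exp (l * η ω) | m]) ω ∂μ
          ≤ ∫ ω in s, Real.exp (l ^ 2 * σ ^ 2 / 2) ∂μ :=
        integral_mono_ae integrable_condExp.integrableOn (integrable_const _)
          (ae_restrict_of_ae hle)
      rw [setIntegral_const, smul_eq_mul] at h1
      calc _ ≤ Real.exp (-(l ^ 2 * σ ^ 2 / 2)) * (μ.real s * Real.exp (l ^ 2 * σ ^ 2 / 2)) := by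
            gcongr
        _ = μ.real s * (Real.exp (-(l ^ 2 * σ ^ 2 / 2)) * Real.exp (l ^ 2 * σ ^ 2 / 2)) := by ring
        _ = _ := by rw [← Real.exp_add]; simp [Measure.real]
    · simp_rw [hfe]
      exact (hint.const_mul _).integrableOn
    · exact ae_of_all _ fun ω => (Real.exp_pos _).le
  calc ∫⁻ ω, G ω * f ω ∂μ = ∫⁻ ω, G ω ∂(μ.withDensity f) := by
        rw [lintegral_withDensity_eq_lintegral_mul _ hf (hG.mono hm le_rfl)]
        simp [mul_comm]
    _ = ∫⁻ ω, G ω ∂(μ.withDensity f).trim hm := (lintegral_trim hm hG).symm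
    _ ≤ ∫⁻ ω, G ω ∂μ.trim hm := lintegral_mono' hmeas le_rfl
    _ = ∫⁻ ω, G ω ∂μ := lintegral_trim hm hG

/-- The hypothesis holds almost surely for each fixed `l`, with an `l`-dependent null set, so a
random `Z` cannot be substituted directly. A `Z` of finite range is handled level set by level set,
the general one by Fatou. -/
lemma IsCondSubgaussian.lintegral_le (hm : m ≤ mΩ) (hη : Measurable η)
    (h : IsCondSubgaussian μ m σ η) {Z : Ω → ℝ} (hZ : Measurable[m] Z)
    {G : Ω → ℝ≥0∞} (hG : Measurable[m] G) :
    ∫⁻ ω, G ω * ENNReal.ofReal (Real.exp (Z ω * η ω - Z ω ^ 2 * σ ^ 2 / 2)) ∂μ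
      ≤ ∫⁻ ω, G ω ∂μ := by
  obtain ⟨Z', hZ', hfin, hlim⟩ := exists_finite_range_tendsto hZ
  set F : ℝ → Ω → ℝ≥0∞ := fun r ω =>
    ENNReal.ofReal (Real.exp (r * η ω - r ^ 2 * σ ^ 2 / 2))
  have hsimple : ∀ n, ∫⁻ ω, G ω * F (Z' n ω) ω ∂μ ≤ ∫⁻ ω, G ω ∂μ := by
    intro n
    set g := Z' n
    have hms : ∀ r, MeasurableSet[m] (g ⁻¹' {r}) := fun r => hZ' n (measurableSet_singleton r)
    have hGr : ∀ r, Measurable[m] ((g ⁻¹' {r}).indicator G) := fun r => hG.indicator (hms r)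
    have hsum : ∀ H : Ω → ℝ≥0∞, ∀ ω, H ω = ∑ r ∈ (hfin n).toFinset, (g ⁻¹' {r}).indicator H ω := by
      intro H ω
      rw [Finset.sum_eq_single (g ω)]
      · simp
      · intro r _ hr
        simp [hr.symm]
      · intro h
        exact absurd ((hfin n).mem_toFinset.2 (Set.mem_range_self ω)) h
    calc ∫⁻ ω, G ω * F (g ω) ω ∂μ
        = ∫⁻ ω, ∑ r ∈ (hfin n).toFinset, (g ⁻¹' {r}).indicator G ω * F r ω ∂μ := by
          refine lintegral_congr fun ω => ?_
          rw [hsum (fun ω => G ω * F (g ω) ω) ω]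
          refine Finset.sum_congr rfl fun r _ => ?_
          by_cases hr : g ω = r
          · simp [hr]
          · simp [hr]
      _ = ∑ r ∈ (hfin n).toFinset, ∫⁻ ω, (g ⁻¹' {r}).indicator G ω * F r ω ∂μ := by
          refine lintegral_finsetSum _ fun r _ => ?_
          exact ((hGr r).mono hm le_rfl).mul (by fun_prop)
      _ ≤ ∑ r ∈ (hfin n).toFinset, ∫⁻ ω, (g ⁻¹' {r}).indicator G ω ∂μ :=
          Finset.sum_le_sum fun r _ => h.lintegral_const_le hm hη r (hGr r)
      _ = ∫⁻ ω, G ω ∂μ := by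
          rw [← lintegral_finsetSum _ fun r _ => (hGr r).mono hm le_rfl]
          exact lintegral_congr fun ω => (hsum G ω).symm
  have hlim' : ∀ ω, Tendsto (fun n => G ω * F (Z' n ω) ω) atTop (𝓝 (G ω * F (Z ω) ω)) := by
    intro ω
    refine ENNReal.Tendsto.const_mul ?_ (Or.inl ?_)
    · refine ENNReal.tendsto_ofReal ?_
      have hc : Continuous fun r : ℝ => Real.exp (r * η ω - r ^ 2 * σ ^ 2 / 2) := by fun_prop
      exact (hc.tendsto _).comp (hlim ω)
    · simp [F, Real.exp_pos]
  calc _ = ∫⁻ ω, liminf (fun n => G ω * F (Z' n ω) ω) atTop ∂μ :=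
        lintegral_congr fun ω => ((hlim' ω).liminf_eq).symm
    _ ≤ liminf (fun n => ∫⁻ ω, G ω * F (Z' n ω) ω ∂μ) atTop := by
        refine lintegral_liminf_le fun n => ?_
        have := (hZ' n).mono hm le_rfl
        exact (hG.mono hm le_rfl).mul (by fun_prop)
    _ ≤ _ := by
        refine (liminf_le_liminf (Eventually.of_forall hsimple)).trans ?_
        simp

/-- The random slope is the predictive law of `⟨λ, x_t⟩`: mean `u / σ²`, variance `w / σ²`. The
right side is the one-step ratio of the mixture. -/
lemma lintegral_exp_gaussianReal (hσ : 0 < σ) (u r : ℝ) {w : ℝ} (hw : 0 ≤ w) :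
    ∫⁻ g, ENNReal.ofReal (Real.exp ((u / σ ^ 2 + √w / σ * g) * r -
        (u / σ ^ 2 + √w / σ * g) ^ 2 * σ ^ 2 / 2)) ∂gaussianReal 0 1 =
      ENNReal.ofReal (Real.exp ((2 * r * u + r ^ 2 * w - u ^ 2) / (1 + w) / (2 * σ ^ 2))
        / √(1 + w)) := by
  have h1w : 0 < 1 + w := by linarith
  set v : NNReal := ⟨(1 + w)⁻¹, (inv_pos.2 h1w).le⟩
  have hv : v ≠ 0 := by
    intro h
    exact (inv_pos.2 h1w).ne' (congrArg NNReal.toReal h)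
  have hvw : (v : ℝ) = (1 + w)⁻¹ := rfl
  set m' : ℝ := √w / σ * (r - u) / (1 + w)
  set C : ℝ := Real.exp ((2 * r * u + r ^ 2 * w - u ^ 2) / (1 + w) / (2 * σ ^ 2)) / √(1 + w)
  have hC : 0 ≤ C := by positivity
  -- Completing the square in `g`: the integrand is a constant times the density of another
  -- Gaussian, with variance `1 / (1 + w)`.
  have key : ∀ g, gaussianPDF 0 1 g * ENNReal.ofReal (Real.exp ((u / σ ^ 2 + √w / σ * g) * r -
        (u / σ ^ 2 + √w / σ * g) ^ 2 * σ ^ 2 / 2)) =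
      ENNReal.ofReal C * gaussianPDF m' v g := by
    intro g
    rw [gaussianPDF, gaussianPDF, ← ENNReal.ofReal_mul (gaussianPDFReal_nonneg _ _ _),
      ← ENNReal.ofReal_mul hC]
    congr 1
    have hs : √(2 * Real.pi * (v : ℝ)) = √(2 * Real.pi) / √(1 + w) := by
      rw [hvw, ← div_eq_mul_inv, Real.sqrt_div (by positivity)]
    have hsw : √w ^ 2 = w := Real.sq_sqrt hw
    rw [gaussianPDFReal, gaussianPDFReal, hs, hvw]
    simp only [NNReal.coe_one, mul_one, sub_zero, C]
    have hne : √(1 + w) ≠ 0 := (Real.sqrt_pos.2 h1w).ne'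
    have hpi : √(2 * Real.pi) ≠ 0 := by positivity
    have e : Real.exp (-g ^ 2 / 2) * Real.exp ((u / σ ^ 2 + √w / σ * g) * r -
        (u / σ ^ 2 + √w / σ * g) ^ 2 * σ ^ 2 / 2) =
        Real.exp ((2 * r * u + r ^ 2 * w - u ^ 2) / (1 + w) / (2 * σ ^ 2)) *
          Real.exp (-(g - m') ^ 2 / (2 * (1 + w)⁻¹)) := by
      rw [← Real.exp_add, ← Real.exp_add]
      congr 1
      have hwq : w = √w ^ 2 := hsw.symm
      simp only [m']
      generalize √w = q at hwq
      subst hwq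
      field_simp
      ring
    rw [mul_assoc, e]
    field_simp
  rw [gaussianReal_of_var_ne_zero _ one_ne_zero,
    lintegral_withDensity_eq_lintegral_mul _ (measurable_gaussianPDF _ _) (by fun_prop)]
  simp only [Pi.mul_apply, key]
  rw [lintegral_const_mul _ (measurable_gaussianPDF _ _), lintegral_gaussianPDF_eq_one _ hv,
    mul_one]

lemma IsCondSubgaussian.lintegral_gaussian_mixture_le (hm : m ≤ mΩ) (hη : Measurable η)
    (h : IsCondSubgaussian μ m σ η) (hσ : 0 < σ) {u w : Ω → ℝ} (hu : Measurable[m] u)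
    (hw : Measurable[m] w) (hw0 : ∀ ω, 0 ≤ w ω) {G : Ω → ℝ≥0∞} (hG : Measurable[m] G) :
    ∫⁻ ω, G ω * ENNReal.ofReal (Real.exp ((2 * η ω * u ω + η ω ^ 2 * w ω - u ω ^ 2) /
        (1 + w ω) / (2 * σ ^ 2)) / √(1 + w ω)) ∂μ ≤ ∫⁻ ω, G ω ∂μ := by
  set Z : ℝ → Ω → ℝ := fun g ω => u ω / σ ^ 2 + √(w ω) / σ * g
  have hZ : ∀ g, Measurable[m] (Z g) := fun g =>
    (hu.div_const _).add ((hw.sqrt.div_const _).mul_const _)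
  set K : ℝ → Ω → ℝ≥0∞ := fun g ω =>
    ENNReal.ofReal (Real.exp (Z g ω * η ω - Z g ω ^ 2 * σ ^ 2 / 2))
  have hu' : Measurable u := hu.mono hm le_rfl
  have hw' : Measurable w := hw.mono hm le_rfl
  have hG' : Measurable G := hG.mono hm le_rfl
  have hK : Measurable fun p : Ω × ℝ => K p.2 p.1 := by
    have h1 : Measurable fun p : Ω × ℝ => Z p.2 p.1 :=
      ((hu'.comp measurable_fst).div_const _).add
        (((hw'.comp measurable_fst).sqrt.div_const _).mul measurable_snd)
    exact ((h1.mul (hη.comp measurable_fst)).sub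
      (((h1.pow_const 2).mul_const _).div_const _)).exp.ennreal_ofReal
  calc _ = ∫⁻ ω, G ω * ∫⁻ g, K g ω ∂gaussianReal 0 1 ∂μ := by
        refine lintegral_congr fun ω => ?_
        rw [lintegral_exp_gaussianReal hσ (u ω) (η ω) (hw0 ω)]
    _ = ∫⁻ ω, ∫⁻ g, G ω * K g ω ∂gaussianReal 0 1 ∂μ := by
        refine lintegral_congr fun ω => (lintegral_const_mul _ ?_).symm
        exact hK.comp measurable_prodMk_left
    _ = ∫⁻ g, ∫⁻ ω, G ω * K g ω ∂μ ∂gaussianReal 0 1 :=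
        lintegral_lintegral_swap ((hG'.comp measurable_fst).mul hK).aemeasurable
    _ ≤ ∫⁻ _, ∫⁻ ω, G ω ∂μ ∂gaussianReal 0 1 :=
        lintegral_mono fun g => h.lintegral_le hm hη (hZ g) hG
    _ = ∫⁻ ω, G ω ∂μ := by
        rw [lintegral_const, measure_univ, mul_one]

end Probability

/-! ### Measurability of the matrix expressions. -/

section Measurability

variable {Ω : Type*} {m : MeasurableSpace Ω} {d : ℕ}

/-- The inverse is the adjugate over the determinant, both polynomial in the entries. -/
lemma measurable_dotProduct_inv_mulVec {A : Ω → Matrix (Fin d) (Fin d) ℝ} {u v : Ω → Fin d → ℝ}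
    (hA : ∀ i j, Measurable fun ω => A ω i j) (hu : Measurable u) (hv : Measurable v) :
    Measurable fun ω => u ω ⬝ᵥ (A ω)⁻¹ *ᵥ v ω := by
  have hdet : Measurable fun ω => (A ω).det := by
    simp only [det_apply']
    fun_prop
  have hadj : ∀ i j, Measurable fun ω => (A ω).adjugate i j := by
    intro i j
    simp only [adjugate_apply, det_apply', updateRow_apply]
    refine Finset.measurable_fun_sum _ fun p _ => Measurable.const_mul ?_ _
    refine Finset.measurable_fun_prod _ fun k _ => ?_
    split_ifs
    · exact measurable_const
    · exact hA _ _
  simp only [inv_def, smul_mulVec, dotProduct_smul, Ring.inverse_eq_inv', smul_eq_mul]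
  refine hdet.inv.mul ?_
  simp only [dotProduct, mulVec]
  fun_prop

lemma measurable_gram_apply {x : ℕ → Ω → Fin d → ℝ} {t : ℕ}
    (hx : ∀ s ∈ Finset.Ico 1 t, Measurable (x s)) (i j : Fin d) :
    Measurable fun ω => gram (fun s => x s ω) t i j := by
  simp only [gram, Matrix.add_apply, Matrix.sum_apply, vecMulVec_apply]
  refine measurable_const.add (Finset.measurable_fun_sum _ fun s hs => ?_)
  have := hx s hs
  fun_prop

lemma measurable_det_gram {x : ℕ → Ω → Fin d → ℝ} {t : ℕ}
    (hx : ∀ s ∈ Finset.Ico 1 t, Measurable (x s)) :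
    Measurable fun ω => (gram (fun s => x s ω) t).det := by
  have := measurable_gram_apply hx
  simp only [det_apply']
  fun_prop

end Measurability

/-! ### The self-normalized supermartingale. -/

section SelfNormalized

variable {d : ℕ}

/-- The vector martingale `∑_{s=1}^{t-1} η_s x_s`. -/
def noiseSum (x : ℕ → Fin d → ℝ) (η : ℕ → ℝ) (t : ℕ) : Fin d → ℝ :=
  ∑ s ∈ Finset.Ico 1 t, η s • x s

/-- The Gaussian mixture `exp(‖S_t‖² / (2σ²)) / √(det A_t)`, in the norm of `A_t⁻¹`, of the
exponential supermartingales of `S_t = ∑_{s=1}^{t-1} η_s x_s`. -/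
def mixture (σ : ℝ) (x : ℕ → Fin d → ℝ) (η : ℕ → ℝ) (t : ℕ) : ℝ :=
  Real.exp ((noiseSum x η t ⬝ᵥ (gram x t)⁻¹ *ᵥ noiseSum x η t) / (2 * σ ^ 2)) /
    √(gram x t).det

lemma noiseSum_succ (x : ℕ → Fin d → ℝ) (η : ℕ → ℝ) {t : ℕ} (ht : 1 ≤ t) :
    noiseSum x η (t + 1) = noiseSum x η t + η t • x t := by
  simp [noiseSum, Finset.sum_Ico_succ_top ht]

lemma mixture_nonneg (σ : ℝ) (x : ℕ → Fin d → ℝ) (η : ℕ → ℝ) (t : ℕ) : 0 ≤ mixture σ x η t := by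
  unfold mixture; positivity

lemma mixture_one (σ : ℝ) (x : ℕ → Fin d → ℝ) (η : ℕ → ℝ) : mixture σ x η 1 = 1 := by
  simp [mixture, noiseSum, gram_one]

/-- Rank-one updates of the inverse and of the determinant put the ratio in the shape of
`lintegral_exp_gaussianReal`, with `r = η_t`. -/
lemma mixture_succ (σ : ℝ) (x : ℕ → Fin d → ℝ) (η : ℕ → ℝ) {t : ℕ} (ht : 1 ≤ t) :
    mixture σ x η (t + 1) = mixture σ x η t *
      (Real.exp ((2 * η t * (x t ⬝ᵥ (gram x t)⁻¹ *ᵥ noiseSum x η t) +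
          η t ^ 2 * (x t ⬝ᵥ (gram x t)⁻¹ *ᵥ x t) -
          (x t ⬝ᵥ (gram x t)⁻¹ *ᵥ noiseSum x η t) ^ 2) /
          (1 + x t ⬝ᵥ (gram x t)⁻¹ *ᵥ x t) / (2 * σ ^ 2)) /
        √(1 + x t ⬝ᵥ (gram x t)⁻¹ *ᵥ x t)) := by
  have hA := gram_posDef x t
  rw [mixture, mixture, noiseSum_succ x η ht, gram_succ x ht, quadForm_inv_add_vecMulVec hA,
    det_add_vecMulVec hA, Real.sqrt_mul hA.det_pos.le, add_div, Real.exp_add]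
  exact mul_div_mul_comm _ _ _ _

variable {Ω : Type*} {mΩ : MeasurableSpace Ω} {μ : Measure Ω} {ℱ : Filtration ℕ mΩ}
  {x : ℕ → Ω → Fin d → ℝ} {η : ℕ → Ω → ℝ} {σ : ℝ}

lemma measurable_noiseSum (hx : ∀ t, 1 ≤ t → Measurable[ℱ t] (x t))
    (hη : ∀ t, 1 ≤ t → Measurable[ℱ (t + 1)] (η t)) (t : ℕ) :
    Measurable[ℱ t] fun ω => noiseSum (fun s => x s ω) (fun s => η s ω) t := by
  refine Finset.measurable_fun_sum _ fun s hs => ?_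
  obtain ⟨h1, h2⟩ := Finset.mem_Ico.1 hs
  exact ((hη s h1).mono (ℱ.mono h2) le_rfl).smul ((hx s h1).mono (ℱ.mono h2.le) le_rfl)

lemma measurable_mixture (hx : ∀ t, 1 ≤ t → Measurable[ℱ t] (x t))
    (hη : ∀ t, 1 ≤ t → Measurable[ℱ (t + 1)] (η t)) (t : ℕ) :
    Measurable[ℱ t] fun ω => mixture σ (fun s => x s ω) (fun s => η s ω) t := by
  have hx' : ∀ s ∈ Finset.Ico 1 t, Measurable[ℱ t] (x s) := fun s hs =>
    (hx s (Finset.mem_Ico.1 hs).1).mono (ℱ.mono (Finset.mem_Ico.1 hs).2.le) le_rfl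
  have hS := measurable_noiseSum hx hη t
  have h1 := measurable_dotProduct_inv_mulVec (measurable_gram_apply hx') hS hS
  exact (h1.div_const _).exp.div (measurable_det_gram hx').sqrt

lemma setLIntegral_mixture_succ_le [IsProbabilityMeasure μ] (hσ : 0 < σ)
    (hx : ∀ t, 1 ≤ t → Measurable[ℱ t] (x t))
    (hη : ∀ t, 1 ≤ t → Measurable[ℱ (t + 1)] (η t))
    (hsub : ∀ t, 1 ≤ t → IsCondSubgaussian μ (ℱ t) σ (η t)) {t : ℕ} (ht : 1 ≤ t)
    {s : Set Ω} (hs : MeasurableSet[ℱ t] s) :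
    ∫⁻ ω in s, ENNReal.ofReal (mixture σ (fun k => x k ω) (fun k => η k ω) (t + 1)) ∂μ ≤
      ∫⁻ ω in s, ENNReal.ofReal (mixture σ (fun k => x k ω) (fun k => η k ω) t) ∂μ := by
  have hx' : ∀ k ∈ Finset.Ico 1 t, Measurable[ℱ t] (x k) := fun k hk =>
    (hx k (Finset.mem_Ico.1 hk).1).mono (ℱ.mono (Finset.mem_Ico.1 hk).2.le) le_rfl
  set u : Ω → ℝ := fun ω => x t ω ⬝ᵥ (gram (fun k => x k ω) t)⁻¹ *ᵥ
    noiseSum (fun k => x k ω) (fun k => η k ω) t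
  set w : Ω → ℝ := fun ω => x t ω ⬝ᵥ (gram (fun k => x k ω) t)⁻¹ *ᵥ x t ω
  have hu : Measurable[ℱ t] u := measurable_dotProduct_inv_mulVec (measurable_gram_apply hx')
    (hx t ht) (measurable_noiseSum hx hη t)
  have hw : Measurable[ℱ t] w := measurable_dotProduct_inv_mulVec (measurable_gram_apply hx')
    (hx t ht) (hx t ht)
  have hw0 : ∀ ω, 0 ≤ w ω := fun ω => quadForm_gram_inv_nonneg _ _ _
  have hηt : Measurable (η t) := (hη t ht).mono (ℱ.le _) le_rfl
  have hM : Measurable[ℱ t] fun ω =>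
      ENNReal.ofReal (mixture σ (fun k => x k ω) (fun k => η k ω) t) :=
    (measurable_mixture hx hη t).ennreal_ofReal
  have h := (hsub t ht).lintegral_gaussian_mixture_le (ℱ.le t) hηt hσ hu hw hw0
    (hM.indicator hs)
  rw [lintegral_indicator (ℱ.le t _ hs)] at h
  refine le_trans (le_of_eq ?_) h
  rw [← lintegral_indicator (ℱ.le t _ hs)]
  refine lintegral_congr fun ω => ?_
  by_cases h : ω ∈ s
  · simp only [Set.indicator_of_mem h]
    rw [mixture_succ _ _ _ ht, ENNReal.ofReal_mul (mixture_nonneg _ _ _ _)]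
  · simp [h]

/-- The self-normalized concentration inequality, uniformly in time. -/
lemma measure_exists_mixture_ge_le [IsProbabilityMeasure μ] (hσ : 0 < σ) {δ : ℝ} (hδ : 0 < δ)
    (hx : ∀ t, 1 ≤ t → Measurable[ℱ t] (x t))
    (hη : ∀ t, 1 ≤ t → Measurable[ℱ (t + 1)] (η t))
    (hsub : ∀ t, 1 ≤ t → IsCondSubgaussian μ (ℱ t) σ (η t)) :
    μ.real {ω | ∃ t, 1 / δ ≤ mixture σ (fun k => x k ω) (fun k => η k ω) (t + 1)} ≤ δ := by
  -- Ville's inequality starts at time 0, the rounds at 1; hence the shift, and the initial value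
  -- `mixture_one`.
  let 𝒢 : Filtration ℕ mΩ :=
    ⟨fun t => ℱ (t + 1), fun i j hij => ℱ.mono (Nat.succ_le_succ hij), fun t => ℱ.le _⟩
  have h := mul_measure_exists_le (μ := μ) (ℱ := 𝒢)
    (a := fun t ω => ENNReal.ofReal (mixture σ (fun k => x k ω) (fun k => η k ω) (t + 1)))
    (fun t => (measurable_mixture hx hη (t + 1)).ennreal_ofReal)
    (fun t s hs => setLIntegral_mixture_succ_le hσ hx hη hsub (Nat.succ_le_succ t.zero_le) hs)
    (ENNReal.ofReal (1 / δ))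
  simp only [zero_add, mixture_one, ENNReal.ofReal_one, lintegral_const, measure_univ,
    mul_one, ENNReal.ofReal_le_ofReal_iff (mixture_nonneg _ _ _ _)] at h
  rw [Measure.real]
  have h2 := ENNReal.toReal_mono ENNReal.one_ne_top h
  rw [ENNReal.toReal_mul, ENNReal.toReal_ofReal (by positivity), ENNReal.toReal_one,
    one_div_mul_eq_div, div_le_one hδ] at h2
  exact h2

end SelfNormalized

/-! ### Confidence widths and optimism. -/

section Confidence

lemma beta_eq (d : ℕ) (σ : ℝ) {δ : ℝ} (hδ : 0 < δ) {t : ℕ} (ht : 1 ≤ t) :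
    beta d σ δ t = 128 * σ ^ 2 * d * Real.log t *
      (2 * Real.log 2 + 2 * Real.log t + Real.log (1 / δ)) := by
  have h0 : (0 : ℝ) < t := by exact_mod_cast ht
  rw [beta, add_sub_cancel, Real.log_div (by positivity) hδ.ne', Real.log_mul (by norm_num)
    (by positivity), Real.log_pow, one_div, Real.log_inv,
    show (4 : ℝ) = 2 ^ 2 by norm_num, Real.log_pow]
  push_cast
  ring

lemma log_one_div_nonneg {δ : ℝ} (hδ : 0 < δ) (hδ1 : δ < 1) : 0 ≤ Real.log (1 / δ) :=
  Real.log_nonneg (by rw [le_div_iff₀ hδ]; linarith)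

lemma beta_mono (d : ℕ) (σ : ℝ) {δ : ℝ} (hδ : 0 < δ) (hδ1 : δ < 1) {t T : ℕ} (ht : 1 ≤ t)
    (htT : t ≤ T) : beta d σ δ t ≤ beta d σ δ T := by
  have h0 : (0 : ℝ) < t := by exact_mod_cast ht
  have h1 : (1 : ℝ) ≤ t := by exact_mod_cast ht
  have hlog : Real.log t ≤ Real.log T := Real.log_le_log h0 (by exact_mod_cast htT)
  have hlog0 : 0 ≤ Real.log t := Real.log_nonneg h1
  have hL := log_one_div_nonneg hδ hδ1
  have h2 : 0 ≤ Real.log 2 := Real.log_nonneg one_le_two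
  rw [beta_eq d σ hδ ht, beta_eq d σ hδ (ht.trans htT)]
  gcongr

lemma log_two_le_log_cast {t : ℕ} (ht : 2 ≤ t) : Real.log 2 ≤ Real.log t :=
  Real.log_le_log two_pos (by exact_mod_cast ht)

lemma four_le_beta {d : ℕ} (hd : 1 ≤ d) {σ δ : ℝ} (hσ : 1 ≤ 7 * σ) (hδ : 0 < δ) (hδ1 : δ < 1)
    {t : ℕ} (ht : 2 ≤ t) : 4 ≤ beta d σ δ t := by
  have hL := log_one_div_nonneg hδ hδ1
  have h2 := Real.log_two_gt_d9
  have hlog := log_two_le_log_cast ht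
  have hd' : (1 : ℝ) ≤ d := by exact_mod_cast hd
  rw [beta_eq d σ hδ (by omega)]
  have hs : 1 / 49 ≤ σ ^ 2 := by nlinarith
  calc (4 : ℝ) ≤ 128 * (1 / 49) * 1 * 0.69 * (2 * 0.69 + 2 * 0.69 + 0) := by norm_num
    _ ≤ _ := by gcongr <;> linarith

/-- The two roots bound the noise and ridge norms. After `(a + b)² ≤ 2a² + 2b²` the ridge part costs
`98 = 2 · 7²`, which the factor 128 absorbs as `log t ≥ log 2`. It fails at `t = 1`, where `β_1 =
0`. -/
lemma sqrt_add_le_sqrt_beta {d : ℕ} (hd : 1 ≤ d) {σ δ : ℝ} (hσ : 0 < σ) (hδ : 0 < δ)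
    (hδ1 : δ < 1) {t : ℕ} (ht : 2 ≤ t) :
    √(σ ^ 2 * (d * Real.log t + 2 * Real.log (1 / δ))) + √((7 * σ) ^ 2 * d) ≤
      √(beta d σ δ t) := by
  have hL := log_one_div_nonneg hδ hδ1
  have h2 := Real.log_two_gt_d9
  have hlog := log_two_le_log_cast ht
  have hd' : (1 : ℝ) ≤ d := by exact_mod_cast hd
  apply Real.le_sqrt_of_sq_le
  rw [beta_eq d σ hδ (by omega)]
  set l := Real.log t
  set L := Real.log (1 / δ)
  have ha : √(σ ^ 2 * (d * l + 2 * L)) ^ 2 = σ ^ 2 * (d * l + 2 * L) :=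
    Real.sq_sqrt (by have : 0 ≤ l := by linarith
                     positivity)
  have hb : √((7 * σ) ^ 2 * d) ^ 2 = (7 * σ) ^ 2 * d := Real.sq_sqrt (by positivity)
  have h1 : 2 * l + 4 * L + 98 ≤ 128 * l * (2 * Real.log 2 + 2 * l + L) := by
    have : 0.69 * (2 * 0.69 + 2 * l + L) ≤ l * (2 * Real.log 2 + 2 * l + L) := by
      gcongr <;> linarith
    nlinarith
  have h3 : L ≤ d * L := by nlinarith
  have h4 : 2 * (d * l + 2 * L) + 98 * d ≤ d * (128 * l * (2 * Real.log 2 + 2 * l + L)) := by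
    have := mul_le_mul_of_nonneg_left h1 (by linarith : (0 : ℝ) ≤ d)
    nlinarith
  have h5 := mul_le_mul_of_nonneg_left h4 (sq_nonneg σ)
  nlinarith [sq_nonneg (√(σ ^ 2 * (d * l + 2 * L)) - √((7 * σ) ^ 2 * d))]

variable {d : ℕ} {X : Set (Fin d → ℝ)} {θ : Fin d → ℝ} {b : (Fin d → ℝ) → ℝ} {ε σ δ : ℝ}
  {x : ℕ → Fin d → ℝ} {y η : ℕ → ℝ}

lemma quadForm_noiseSum_le (hX : ∀ z ∈ X, z ⬝ᵥ z ≤ (d : ℝ)) (hx : ∀ t, 1 ≤ t → x t ∈ X)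
    (hσ : 0 < σ) {t : ℕ} (ht : 1 ≤ t)
    (hgood : mixture σ x η t < 1 / δ) :
    noiseSum x η t ⬝ᵥ (gram x t)⁻¹ *ᵥ noiseSum x η t ≤
      σ ^ 2 * (d * Real.log t + 2 * Real.log (1 / δ)) := by
  have hdet := (gram_posDef x t).det_pos
  have hpos : 0 < mixture σ x η t := by unfold mixture; positivity
  have h := Real.log_le_log hpos hgood.le
  rw [mixture, Real.log_div (Real.exp_pos _).ne' (Real.sqrt_pos.2 hdet).ne', Real.log_exp,
    Real.log_sqrt hdet.le] at h
  have hl := log_det_gram_le x hX hx ht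
  have h2 : noiseSum x η t ⬝ᵥ (gram x t)⁻¹ *ᵥ noiseSum x η t / (2 * σ ^ 2) ≤
      (d * Real.log t + 2 * Real.log (1 / δ)) / 2 := by linarith
  rw [div_le_iff₀ (by positivity)] at h2
  linarith

lemma abs_dotProduct_le (hb : ∀ z ∈ X, |b z| ≤ ε)
    (hmean : ∀ z ∈ X, z ⬝ᵥ θ + b z ∈ Set.Icc (-1 : ℝ) 1) {z : Fin d → ℝ} (hz : z ∈ X) :
    |z ⬝ᵥ θ| ≤ 1 + ε := by
  have h1 := abs_le.1 (hb z hz)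
  have h2 := hmean z hz
  rw [abs_le]
  constructor <;> linarith [h2.1, h2.2]

/-- Playing `e_i` reads off a coordinate, so `|θ_i| ≤ 1 + ε ≤ 7σ`. -/
lemma dotProduct_self_le (hX_basis : ∀ i : Fin d, Pi.single i (1 : ℝ) ∈ X)
    (hb : ∀ z ∈ X, |b z| ≤ ε) (hmean : ∀ z ∈ X, z ⬝ᵥ θ + b z ∈ Set.Icc (-1 : ℝ) 1)
    (hσ : 1 + ε ≤ 7 * σ) : θ ⬝ᵥ θ ≤ (7 * σ) ^ 2 * d := by
  have h : ∀ i, θ i * θ i ≤ (7 * σ) ^ 2 := by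
    intro i
    have h1 := abs_dotProduct_le hb hmean (hX_basis i)
    rw [single_one_dotProduct] at h1
    rw [← sq]
    exact sq_le_sq' (by linarith [neg_abs_le (θ i)]) (by linarith [le_abs_self (θ i)])
  calc θ ⬝ᵥ θ ≤ ∑ _i : Fin d, (7 * σ) ^ 2 := Finset.sum_le_sum fun i _ => h i
    _ = _ := by simp [mul_comm]

lemma dotProduct_thetaHat (hy : ∀ t, 1 ≤ t → y t = x t ⬝ᵥ θ + b (x t) + η t) (t : ℕ)
    (z : Fin d → ℝ) : z ⬝ᵥ thetaHat x y t = z ⬝ᵥ θ - z ⬝ᵥ (gram x t)⁻¹ *ᵥ θ +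
      z ⬝ᵥ (gram x t)⁻¹ *ᵥ noiseSum x η t +
      ∑ s ∈ Finset.Ico 1 t, b (x s) * (z ⬝ᵥ (gram x t)⁻¹ *ᵥ x s) := by
  have h : ∑ s ∈ Finset.Ico 1 t, y s • x s = gram x t *ᵥ θ - θ + noiseSum x η t +
      ∑ s ∈ Finset.Ico 1 t, b (x s) • x s := by
    rw [gram, add_mulVec, one_mulVec, add_sub_cancel_left, sum_mulVec, noiseSum,
      ← Finset.sum_add_distrib, ← Finset.sum_add_distrib]
    refine Finset.sum_congr rfl fun s hs => ?_
    rw [hy s (Finset.mem_Ico.1 hs).1, vecMulVec_mulVec]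
    ext i
    simp
    ring
  rw [thetaHat, h, mulVec_add, mulVec_add, mulVec_sub, inv_mulVec_mulVec (gram_posDef x t),
    dotProduct_add, dotProduct_add, dotProduct_sub, mulVec_sum, dotProduct_sum]
  simp [mulVec_smul]

lemma abs_dotProduct_thetaHat_sub_le (hd : 1 ≤ d) (hX_norm : ∀ z ∈ X, z ⬝ᵥ z ≤ (d : ℝ))
    (hX_basis : ∀ i : Fin d, Pi.single i (1 : ℝ) ∈ X) (hb : ∀ z ∈ X, |b z| ≤ ε)
    (hmean : ∀ z ∈ X, z ⬝ᵥ θ + b z ∈ Set.Icc (-1 : ℝ) 1) (hσ : 1 + ε ≤ 7 * σ) (hσ0 : 0 < σ)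
    (hδ : 0 < δ) (hδ1 : δ < 1) (hx : ∀ t, 1 ≤ t → x t ∈ X)
    (hy : ∀ t, 1 ≤ t → y t = x t ⬝ᵥ θ + b (x t) + η t) {t : ℕ} (ht : 2 ≤ t)
    (hgood : mixture σ x η t < 1 / δ) (z : Fin d → ℝ) :
    |z ⬝ᵥ thetaHat x y t - z ⬝ᵥ θ| ≤ √(beta d σ δ t) * √(z ⬝ᵥ (gram x t)⁻¹ *ᵥ z) +
      ε * ∑ s ∈ Finset.Ico 1 t, |z ⬝ᵥ (gram x t)⁻¹ *ᵥ x s| := by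
  have hP := (gram_posDef x t).inv.posSemidef
  have h1 : |z ⬝ᵥ (gram x t)⁻¹ *ᵥ θ| ≤ √(z ⬝ᵥ (gram x t)⁻¹ *ᵥ z) * √((7 * σ) ^ 2 * d) :=
    (abs_dotProduct_mulVec_le hP z θ).trans (by
      gcongr
      exact (quadForm_gram_inv_le x t θ).trans (dotProduct_self_le hX_basis hb hmean hσ))
  have h2 : |z ⬝ᵥ (gram x t)⁻¹ *ᵥ noiseSum x η t| ≤ √(z ⬝ᵥ (gram x t)⁻¹ *ᵥ z) *
      √(σ ^ 2 * (d * Real.log t + 2 * Real.log (1 / δ))) :=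
    (abs_dotProduct_mulVec_le hP z _).trans (by
      gcongr
      exact quadForm_noiseSum_le hX_norm hx hσ0 (by omega) hgood)
  have h3 : |∑ s ∈ Finset.Ico 1 t, b (x s) * (z ⬝ᵥ (gram x t)⁻¹ *ᵥ x s)| ≤
      ε * ∑ s ∈ Finset.Ico 1 t, |z ⬝ᵥ (gram x t)⁻¹ *ᵥ x s| := by
    rw [Finset.mul_sum]
    refine (Finset.abs_sum_le_sum_abs _ _).trans (Finset.sum_le_sum fun s hs => ?_)
    rw [abs_mul]
    exact mul_le_mul_of_nonneg_right (hb _ (hx s (Finset.mem_Ico.1 hs).1)) (abs_nonneg _)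
  have h4 := mul_le_mul_of_nonneg_left (sqrt_add_le_sqrt_beta hd hσ0 hδ hδ1 ht)
    (Real.sqrt_nonneg (z ⬝ᵥ (gram x t)⁻¹ *ᵥ z))
  rw [dotProduct_thetaHat hy]
  rw [abs_le] at h1 h2 h3 ⊢
  constructor <;> nlinarith

/-- On the confidence event the instantaneous regret is at most twice the exploration bonus. -/
lemma iSup_sub_le (hd : 1 ≤ d) (hX_norm : ∀ z ∈ X, z ⬝ᵥ z ≤ (d : ℝ))
    (hX_basis : ∀ i : Fin d, Pi.single i (1 : ℝ) ∈ X) (hb : ∀ z ∈ X, |b z| ≤ ε)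
    (hmean : ∀ z ∈ X, z ⬝ᵥ θ + b z ∈ Set.Icc (-1 : ℝ) 1) (hσ : 1 + ε ≤ 7 * σ) (hσ0 : 0 < σ)
    (hδ : 0 < δ) (hδ1 : δ < 1) (hx : ∀ t, 1 ≤ t → x t ∈ X)
    (hy : ∀ t, 1 ≤ t → y t = x t ⬝ᵥ θ + b (x t) + η t)
    {t : ℕ} (ht : 2 ≤ t) (hmax : IsMaxOn (ucb ε σ δ x y t) X (x t))
    (hgood : mixture σ x η t < 1 / δ) :
    (⨆ z : X, (z : Fin d → ℝ) ⬝ᵥ θ) - x t ⬝ᵥ θ ≤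
      2 * (√(beta d σ δ t) * √(x t ⬝ᵥ (gram x t)⁻¹ *ᵥ x t)) +
      2 * ε * ∑ s ∈ Finset.Ico 1 t, |x t ⬝ᵥ (gram x t)⁻¹ *ᵥ x s| := by
  have hconf := abs_dotProduct_thetaHat_sub_le hd hX_norm hX_basis hb hmean hσ hσ0 hδ hδ1 hx hy ht
    hgood
  have : Nonempty X := ⟨⟨x 1, hx 1 le_rfl⟩⟩
  rw [sub_le_iff_le_add]
  refine ciSup_le fun z => ?_
  have h1 := hmax z.2
  simp only [Set.mem_ofPred_eq, ucb] at h1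
  have h2 := (abs_le.1 (hconf z)).1
  have h3 := (abs_le.1 (hconf (x t))).2
  linarith

lemma iSup_sub_le_two (hb : ∀ z ∈ X, |b z| ≤ ε)
    (hmean : ∀ z ∈ X, z ⬝ᵥ θ + b z ∈ Set.Icc (-1 : ℝ) 1) {z : Fin d → ℝ} (hz : z ∈ X) :
    (⨆ z : X, (z : Fin d → ℝ) ⬝ᵥ θ) - z ⬝ᵥ θ ≤ 2 + 2 * ε := by
  have : Nonempty X := ⟨⟨z, hz⟩⟩
  rw [sub_le_iff_le_add]
  refine ciSup_le fun z' => ?_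
  have h2 := (abs_le.1 (abs_dotProduct_le hb hmean z'.2)).2
  have h3 := (abs_le.1 (abs_dotProduct_le hb hmean hz)).1
  linarith

end Confidence

/-! ### Summing the regret. -/

section Regret

/-- From `log (1 + m) ≥ 2m / (m + 2)` with `m = min 1 w ≤ 1`. -/
lemma min_one_le_log {w : ℝ} (hw : 0 ≤ w) : min 1 w ≤ 3 / 2 * Real.log (1 + w) := by
  have hm : 0 ≤ min 1 w := le_min zero_le_one hw
  have h1 := Real.le_log_one_add_of_nonneg hm
  have h2 : Real.log (1 + min 1 w) ≤ Real.log (1 + w) :=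
    Real.log_le_log (by linarith) (by linarith [min_le_right 1 w])
  have h3 : min 1 w ≤ 3 / 2 * (2 * min 1 w / (min 1 w + 2)) := by
    have : min 1 w ≤ 1 := min_le_left 1 w
    rw [← mul_div_assoc, le_div_iff₀ (by linarith)]
    nlinarith
  linarith

lemma sum_le_sqrt_mul {ι : Type*} (s : Finset ι) (f : ι → ℝ) {c : ℝ}
    (h : ∑ i ∈ s, f i ^ 2 ≤ c) : ∑ i ∈ s, f i ≤ √(s.card * c) :=
  Real.le_sqrt_of_sq_le (sq_sum_le_card_mul_sum_sq.trans
    (mul_le_mul_of_nonneg_left h (Nat.cast_nonneg _)))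

variable {d : ℕ} {X : Set (Fin d → ℝ)} {θ : Fin d → ℝ} {b : (Fin d → ℝ) → ℝ} {ε σ δ : ℝ}
  {x : ℕ → Fin d → ℝ} {y η : ℕ → ℝ}

/-- The elliptical potential lemma. -/
lemma sum_log_one_add_le (hX : ∀ z ∈ X, z ⬝ᵥ z ≤ (d : ℝ)) (hx : ∀ t, 1 ≤ t → x t ∈ X) (T : ℕ) :
    ∑ t ∈ Finset.Icc 1 T, Real.log (1 + x t ⬝ᵥ (gram x t)⁻¹ *ᵥ x t) ≤
      d * Real.log (1 + T) := by
  have h := log_det_gram_le x hX hx (Nat.le_add_left 1 T)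
  rw [log_det_gram_eq x (Nat.le_add_left 1 T)] at h
  push_cast at h
  rwa [add_comm (1 : ℝ) T]

lemma sum_bias_le (hd : 1 ≤ d) (hX : ∀ z ∈ X, z ⬝ᵥ z ≤ (d : ℝ)) (hx : ∀ t, 1 ≤ t → x t ∈ X)
    (T : ℕ) :
    ∑ t ∈ Finset.Icc 1 T, ∑ s ∈ Finset.Ico 1 t, |x t ⬝ᵥ (gram x t)⁻¹ *ᵥ x s| ≤
      T * d * √(2 * Real.log (1 + T)) := by
  have hd' : (1 : ℝ) ≤ d := by exact_mod_cast hd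
  have hround : ∀ t ∈ Finset.Icc 1 T, ∑ s ∈ Finset.Ico 1 t, |x t ⬝ᵥ (gram x t)⁻¹ *ᵥ x s| ≤
      √T * √(x t ⬝ᵥ (gram x t)⁻¹ *ᵥ x t) := by
    intro t ht
    have htT := (Finset.mem_Icc.1 ht).2
    refine (sum_le_sqrt_mul _ _ (c := x t ⬝ᵥ (gram x t)⁻¹ *ᵥ x t) ?_).trans ?_
    · simpa only [sq_abs] using sum_sq_le_quadForm_gram_inv x t (x t)
    · rw [← Real.sqrt_mul (Nat.cast_nonneg T)]
      refine Real.sqrt_le_sqrt (mul_le_mul_of_nonneg_right ?_ (quadForm_gram_inv_nonneg x t _))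
      rw [Nat.card_Ico]
      exact_mod_cast (Nat.sub_le t 1).trans htT
  -- No truncation is available here; `W_t ≤ |x_t|² ≤ d` gives `W_t ≤ d · min 1 W_t`, hence the
  -- extra factor `d`.
  have hw : ∀ t ∈ Finset.Icc 1 T, x t ⬝ᵥ (gram x t)⁻¹ *ᵥ x t ≤
      2 * d * Real.log (1 + x t ⬝ᵥ (gram x t)⁻¹ *ᵥ x t) := by
    intro t ht
    have h0 := quadForm_gram_inv_nonneg x t (x t)
    have h1 := min_one_le_log h0
    have h2 := (quadForm_gram_inv_le x t (x t)).trans (hX _ (hx t (Finset.mem_Icc.1 ht).1))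
    have h3 : 0 ≤ Real.log (1 + x t ⬝ᵥ (gram x t)⁻¹ *ᵥ x t) := Real.log_nonneg (by linarith)
    rcases min_cases 1 (x t ⬝ᵥ (gram x t)⁻¹ *ᵥ x t) with h | h <;> rw [h.1] at h1 <;> nlinarith
  have hsum : ∑ t ∈ Finset.Icc 1 T, √(x t ⬝ᵥ (gram x t)⁻¹ *ᵥ x t) ≤
      √((Finset.Icc 1 T).card * (2 * d * (d * Real.log (1 + T)))) := by
    refine sum_le_sqrt_mul _ _ ?_
    calc _ = ∑ t ∈ Finset.Icc 1 T, x t ⬝ᵥ (gram x t)⁻¹ *ᵥ x t :=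
          Finset.sum_congr rfl fun t _ => Real.sq_sqrt (quadForm_gram_inv_nonneg x t _)
      _ ≤ _ := Finset.sum_le_sum hw
      _ ≤ _ := by
        rw [← Finset.mul_sum]
        exact mul_le_mul_of_nonneg_left (sum_log_one_add_le hX hx T) (by positivity)
  refine (Finset.sum_le_sum hround).trans ?_
  rw [← Finset.mul_sum]
  refine (mul_le_mul_of_nonneg_left hsum (Real.sqrt_nonneg _)).trans_eq ?_
  rw [Nat.card_Icc, Nat.add_sub_cancel,
    show (T : ℝ) * (2 * d * (d * Real.log (1 + T))) = T * (d ^ 2 * (2 * Real.log (1 + T))) by ring,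
    Real.sqrt_mul (Nat.cast_nonneg T), Real.sqrt_mul (by positivity),
    Real.sqrt_sq (by positivity), ← mul_assoc, Real.mul_self_sqrt (Nat.cast_nonneg T), mul_assoc]

lemma regret_le (hd : 1 ≤ d) (hX_norm : ∀ z ∈ X, z ⬝ᵥ z ≤ (d : ℝ))
    (hX_basis : ∀ i : Fin d, Pi.single i (1 : ℝ) ∈ X) (hb : ∀ z ∈ X, |b z| ≤ ε)
    (hmean : ∀ z ∈ X, z ⬝ᵥ θ + b z ∈ Set.Icc (-1 : ℝ) 1) (hσ : 1 + ε ≤ 7 * σ)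
    (hδ : 0 < δ) (hδ1 : δ < 1) (hrun : IsRun X ε σ δ x y)
    (hy : ∀ t, 1 ≤ t → y t = x t ⬝ᵥ θ + b (x t) + η t)
    (hgood : ∀ t, 1 ≤ t → mixture σ x η t < 1 / δ) {T : ℕ} (hT : 2 ≤ T) :
    regret X θ x T ≤ √(8 * d * beta d σ δ T * T * Real.log (1 + T)) +
      2 * ε * T * d * √(2 * Real.log (1 + T)) + 2 * ε * T := by
  have hx : ∀ t, 1 ≤ t → x t ∈ X := by
    intro t ht
    obtain rfl | h := ht.eq_or_lt
    · exact hrun.first_mem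
    · obtain ⟨k, rfl⟩ := Nat.exists_eq_add_of_lt h
      exact hrun.next_mem _ (by omega)
  have hε : 0 ≤ ε := (abs_nonneg _).trans (hb _ (hx 1 le_rfl))
  have hσ0 : 0 < σ := by linarith
  have hd' : (1 : ℝ) ≤ d := by exact_mod_cast hd
  set W : ℕ → ℝ := fun t => x t ⬝ᵥ (gram x t)⁻¹ *ᵥ x t
  set B : ℕ → ℝ := fun t => ∑ s ∈ Finset.Ico 1 t, |x t ⬝ᵥ (gram x t)⁻¹ *ᵥ x s|
  set β := beta d σ δ T
  have hW : ∀ t, 0 ≤ W t := fun t => quadForm_gram_inv_nonneg x t _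
  have hB : ∀ t, 0 ≤ B t := fun t => Finset.sum_nonneg fun _ _ => abs_nonneg _
  have hβ : 4 ≤ β := four_le_beta hd (by linarith) hδ hδ1 hT
  -- The truncation at 1 is the trivial bound `2 + 2ε`, whose excess `2ε` per round becomes the term
  -- `2εT`. Round 1 has no confidence bound and is charged the full 1.
  set v : ℕ → ℝ := fun t => if t = 1 then 1 else min 1 (√β * √(W t))
  have hinst : ∀ t ∈ Finset.Icc 1 T,
      (⨆ z : X, (z : Fin d → ℝ) ⬝ᵥ θ) - x t ⬝ᵥ θ ≤ 2 * v t + 2 * ε + 2 * ε * B t := by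
    intro t ht
    obtain ⟨ht1, htT⟩ := Finset.mem_Icc.1 ht
    have h1 := iSup_sub_le_two hb hmean (hx t ht1)
    have h2 := mul_nonneg hε (hB t)
    by_cases h : t = 1
    · simp only [v, h, if_true] at h1 h2 ⊢
      linarith
    · simp only [v, h, if_false]
      obtain ⟨k, rfl⟩ := Nat.exists_eq_add_of_le' ht1
      have h3 := iSup_sub_le hd hX_norm hX_basis hb hmean hσ hσ0 hδ hδ1 hx hy (t := k + 1)
        (by omega) (hrun.next_max k (by omega)) (hgood _ ht1)
      have h4 : √(beta d σ δ (k + 1)) * √(W (k + 1)) ≤ √β * √(W (k + 1)) := by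
        gcongr
        exact beta_mono d σ hδ hδ1 ht1 htT
      rcases min_cases 1 (√β * √(W (k + 1))) with h | h <;> rw [h.1] <;> linarith
  have hv : ∀ t, v t ^ 2 ≤ (if t = 1 then 1 else 0) + 3 / 2 * β * Real.log (1 + W t) := by
    intro t
    have hlog : 0 ≤ Real.log (1 + W t) := Real.log_nonneg (by linarith [hW t])
    by_cases h : t = 1
    · simp only [v, h, if_true] at hlog ⊢
      have : 0 ≤ 3 / 2 * β * Real.log (1 + W 1) := by positivity
      linarith
    · simp only [v, h, if_false, zero_add]
      rw [← Real.sqrt_mul (by linarith)]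
      have h1 : min 1 √(β * W t) ^ 2 ≤ β * min 1 (W t) := by
        have h0 : 0 ≤ min 1 √(β * W t) := le_min zero_le_one (Real.sqrt_nonneg _)
        rcases min_cases 1 (W t) with hm | hm <;> rw [hm.1]
        · nlinarith [min_le_left 1 √(β * W t)]
        · refine (pow_le_pow_left₀ h0 (min_le_right _ _) 2).trans_eq ?_
          exact Real.sq_sqrt (mul_nonneg (by linarith) (hW t))
      have h2 := mul_le_mul_of_nonneg_left (min_one_le_log (hW t)) (by linarith : 0 ≤ β)
      linarith
  have hsumlog := sum_log_one_add_le hX_norm hx T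
  have hlogT : Real.log 2 ≤ Real.log (1 + T) :=
    Real.log_le_log two_pos (by have : (2 : ℝ) ≤ T := by exact_mod_cast hT
                                linarith)
  have hsumv : ∑ t ∈ Finset.Icc 1 T, v t ^ 2 ≤ 2 * β * (d * Real.log (1 + T)) := by
    calc _ ≤ ∑ t ∈ Finset.Icc 1 T,
          ((if t = 1 then 1 else 0) + 3 / 2 * β * Real.log (1 + W t)) :=
          Finset.sum_le_sum fun t _ => hv t
      _ = 1 + 3 / 2 * β * ∑ t ∈ Finset.Icc 1 T, Real.log (1 + W t) := by
          rw [Finset.sum_add_distrib, ← Finset.mul_sum, Finset.sum_ite_eq' (Finset.Icc 1 T) 1,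
            if_pos (Finset.mem_Icc.2 ⟨le_rfl, by omega⟩)]
      _ ≤ 1 + 3 / 2 * β * (d * Real.log (1 + T)) := by gcongr
      -- The 1 from the first round fits in the slack between `3/2` and `2`, since `β ≥ 4` and `log
      -- (1 + T) ≥ log 2`.
      _ ≤ _ := by
          have h2 := Real.log_two_gt_d9
          have h3 : (1 : ℝ) * 0.69 ≤ d * Real.log (1 + T) := by gcongr; linarith
          nlinarith
  have hsv : ∑ t ∈ Finset.Icc 1 T, v t ≤ √(T * (2 * β * (d * Real.log (1 + T)))) := by
    simpa using sum_le_sqrt_mul _ _ hsumv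
  have h8 : √(8 * d * β * T * Real.log (1 + T)) =
      2 * √(T * (2 * β * (d * Real.log (1 + T)))) := by
    rw [show 8 * d * β * T * Real.log (1 + T) =
      2 ^ 2 * (T * (2 * β * (d * Real.log (1 + T)))) by ring, Real.sqrt_mul (by norm_num),
      Real.sqrt_sq (by norm_num)]
  have hbias := mul_le_mul_of_nonneg_left (sum_bias_le hd hX_norm hx T)
    (by positivity : 0 ≤ 2 * ε)
  calc regret X θ x T ≤ ∑ t ∈ Finset.Icc 1 T, (2 * v t + 2 * ε + 2 * ε * B t) :=
        Finset.sum_le_sum hinst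
    _ = 2 * ∑ t ∈ Finset.Icc 1 T, v t + 2 * ε * T + 2 * ε * ∑ t ∈ Finset.Icc 1 T, B t := by
        simp [Finset.sum_add_distrib, Finset.mul_sum, mul_comm]
    _ ≤ _ := by
        rw [h8]
        linarith

lemma regret_eq_zero (hd : d = 0) (T : ℕ) : regret X θ x T = 0 := by
  subst hd
  simp [regret]

end Regret

end MisLinUCB

end

/-! ### The good event and the conclusion. -/

theorem theorem1 {d : ℕ} (X : Set (Fin d → ℝ))
    (hX_norm : ∀ z ∈ X, z ⬝ᵥ z ≤ (d : ℝ))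
    (hX_basis : ∀ i : Fin d, Pi.single i (1 : ℝ) ∈ X)
    (θ : Fin d → ℝ) (b : (Fin d → ℝ) → ℝ) (ε σ δ : ℝ)
    (hb : ∀ z ∈ X, |b z| ≤ ε)
    (hmean : ∀ z ∈ X, z ⬝ᵥ θ + b z ∈ Set.Icc (-1 : ℝ) 1)
    (hσ : 1 + ε ≤ 7 * σ)
    (hδ_pos : 0 < δ) (hδ_lt : δ < 1)
    {Ω : Type*} {mΩ : MeasurableSpace Ω} (μ : Measure Ω) [IsProbabilityMeasure μ]
    (ℱ : Filtration ℕ mΩ)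
    (x : ℕ → Ω → Fin d → ℝ) (y η : ℕ → Ω → ℝ)
    (hx_meas : ∀ t, 1 ≤ t → Measurable[ℱ t] (x t))
    (hη_meas : ∀ t, 1 ≤ t → Measurable[ℱ (t + 1)] (η t))
    (hη_sub : ∀ t, 1 ≤ t → MisLinUCB.IsCondSubgaussian μ (ℱ t) σ (η t))
    (hy : ∀ t, 1 ≤ t → ∀ ω, y t ω = x t ω ⬝ᵥ θ + b (x t ω) + η t ω)
    (hrun : ∀ ω, MisLinUCB.IsRun X ε σ δ (fun t => x t ω) (fun t => y t ω)) :
    1 - δ ≤ μ.real {ω | ∀ T : ℕ, 2 ≤ T →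
      MisLinUCB.regret X θ (fun t => x t ω) T ≤
        Real.sqrt (8 * d * MisLinUCB.beta d σ δ T * T * Real.log (1 + T))
          + 2 * ε * T * d * Real.sqrt (2 * Real.log (1 + T))
          + 2 * ε * T} := by
  obtain ⟨ω₀⟩ : Nonempty Ω := nonempty_of_isProbabilityMeasure μ
  have hε : 0 ≤ ε := (abs_nonneg _).trans (hb _ (hrun ω₀).first_mem)
  have hσ0 : 0 < σ := by linarith
  set E : Set Ω := {ω | ∃ t, 1 / δ ≤
    MisLinUCB.mixture σ (fun k => x k ω) (fun k => η k ω) (t + 1)}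
  have hE : μ.real E ≤ δ :=
    MisLinUCB.measure_exists_mixture_ge_le hσ0 hδ_pos hx_meas hη_meas hη_sub
  have hE_meas : MeasurableSet E := by
    have hrw : E = ⋃ t, {ω | 1 / δ ≤
        MisLinUCB.mixture σ (fun k => x k ω) (fun k => η k ω) (t + 1)} := by
      ext; simp [E]
    rw [hrw]
    exact MeasurableSet.iUnion fun t => measurableSet_le measurable_const
      ((MisLinUCB.measurable_mixture hx_meas hη_meas (t + 1)).mono (ℱ.le _) le_rfl)
  calc 1 - δ ≤ 1 - μ.real E := by linarith
    _ = μ.real Eᶜ := (probReal_compl_eq_one_sub hE_meas).symm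
    _ ≤ _ := by
      refine measureReal_mono fun ω hω T hT => ?_
      -- The statement admits `d = 0`, where the regret vanishes; the bounds above need `d ≥ 1`.
      rcases Nat.eq_zero_or_pos d with hd | hd
      · rw [MisLinUCB.regret_eq_zero hd]
        positivity
      · refine MisLinUCB.regret_le hd hX_norm hX_basis hb hmean hσ hδ_pos hδ_lt (hrun ω)
          (fun t ht => hy t ht ω) (fun t ht => ?_) hT
        obtain ⟨k, rfl⟩ := Nat.exists_eq_add_of_le' ht
        exact not_le.1 fun h => hω ⟨k, h⟩
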